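/- Let $d\ge 0$ and let $X_{i;n}$ ($i\in[d]=\{1,\dots,d\}$, $n\in\{1,2,\dots\}$) be $\{0,1\}$-valued random variables on a common probability space. For $S\subseteq[d]$ write $X_{S;n}=(X_{j;n})_{j\in S}$ and $X_{S;[n]}=(X_{j;m})_{j\in S,\,1\le m\le n}$. Suppose that the following three conditions hold. 1. The sequence of $d$-tuples $(X_{1;n},\dots,X_{d;n})_{n\ge 1}$ is infinitely exchangeable: for every $N$, the joint law of the first $N$ tuples is invariant under every permutation of these tuples. 2. $\mathcal G$ is a directed acyclic graph on $[d]$ such that, for all $i\in[d]$ and all $n$, $$X_{i;[n]}\ \perp\!\!\!\perp\ \bigl(X_{\overline{ND}_i;[n]},\,X_{ND_i;n+1}\bigr)\ \Big|\ X_{PA_i;[n]} ,$$ where $PA_i$ is the set of parents of $i$ in $\mathcal G$, $ND_i$ is the set of nodes $j\neq i$ that cannot be reached from $i$ by a directed path, and $\overline{ND}_i=ND_i\setminus PA_i$. 3. For every node $i$ with at least two parents, the following event has positive probability: every $a\in\{0,1\}^{PA_i}$ with $P(X_{PA_i;1}=a)>0$ occurs among $X_{PA_i;1},X_{PA_i;2},\dots$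 Then there are probability measures $\nu_i$ on $[0,1]^{\{0,1\}^{PA_i}}\cong[0,1]^{2^{|PA_i|}}$, $i\in[d]$, such that for all $N$ and all $x_{i;n}\in\{0,1\}$ ($i\in[d]$, $1\le n\le N$) $$P\bigl(X_{i;n}=x_{i;n}\ \text{for all } i\in[d],\ 1\le n\le N\bigr)=\int\prod_{n=1}^N\prod_{i=1}^d p\bigl(x_{i;n}\mid x_{PA_i;n},\theta_i\bigr)\,d(\nu_1\otimes\cdots\otimes\nu_d)(\theta_1,\dots,\theta_d),$$ where $p(1\mid a,\theta_i)=\theta_i(a)$ and $p(0\mid a,\theta_i)=1-\theta_i(a)$. That is, the joint law is a mixture, over independent latent parameters $\theta_1,\dots,\theta_d$ with laws $\nu_1,\dots,\nu_d$, of laws of i.i.d. sequences of binary $d$-tuples that all Markov-factorize according to $\mathcal G$. -/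

import Mathlib

open MeasureTheory ProbabilityTheory

noncomputable section

namespace CausalDeFinetti

/-! ### Directed acyclic graphs on the node set `{0, …, d - 1}` -/

section Graph

variable {d : ℕ}

/-- `G` is acyclic: there is no directed cycle `v → ⋯ → v` of positive length. -/
def IsDAG (G : Digraph (Fin d)) : Prop :=
  ∀ v, ¬ Relation.TransGen G.Adj v v

/-- The parents `PA_i` of the node `i`. -/
def parents (G : Digraph (Fin d)) (i : Fin d) : Set (Fin d) :=
  {j | G.Adj j i}

/-- The non-descendants `ND_i` of the node `i`: all nodes other than `i` itself that cannot be
reached from `i` by a directed path. -/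
def nonDescendants (G : Digraph (Fin d)) (i : Fin d) : Set (Fin d) :=
  {j | j ≠ i ∧ ¬ Relation.TransGen G.Adj i j}

/-- The non-descendants of `i` that are not parents of `i`. -/
def nonParentNonDescendants (G : Digraph (Fin d)) (i : Fin d) : Set (Fin d) :=
  nonDescendants G i \ parents G i

end Graph

/-! ### Sequences of binary `d`-tuples

`X i n` is the `i`-th coordinate of the `n`-th sample, the samples being numbered `0, 1, 2, …`. So
the first `n` samples are numbered by `Fin n`, and the sample that comes after them has number
`n`. -/

section Sequences

variable {Ω : Type*} {d : ℕ}

/-- `X_{S;n}`: the coordinates of the sample `n` that belong to the set of nodes `S`. -/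
def sample (X : Fin d → ℕ → Ω → Bool) (S : Set (Fin d)) (n : ℕ) : Ω → (S → Bool) :=
  fun ω j => X j n ω

/-- `X_{S;[n]}`: the coordinates that belong to `S`, of the first `n` samples. -/
def block (X : Fin d → ℕ → Ω → Bool) (S : Set (Fin d)) (n : ℕ) : Ω → (Fin n → S → Bool) :=
  fun ω m j => X j m ω

variable [MeasurableSpace Ω]

/-- Infinite exchangeability: for every `N`, the joint law of the first `N` of the `d`-tuples is
invariant under all permutations of these tuples. -/
def InfinitelyExchangeable (μ : Measure Ω) (X : Fin d → ℕ → Ω → Bool) : Prop :=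
  ∀ (N : ℕ) (π : Equiv.Perm (Fin N)),
    μ.map (fun ω (m : Fin N) (i : Fin d) => X i (π m) ω) =
      μ.map (fun ω (m : Fin N) (i : Fin d) => X i m ω)

/-- `A ⫫ B | C` for a random variable `C` with finitely many values: given each event `C = c` of
positive probability, `A` and `B` are independent. (If `C = c` has probability zero then
`cond μ (C ⁻¹' {c})` is the zero measure, and nothing is required.) -/
def CondIndepGiven {α β γ : Type*} [MeasurableSpace α] [MeasurableSpace β] [Finite γ]
    (μ : Measure Ω) (A : Ω → α) (B : Ω → β) (C : Ω → γ) : Prop :=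
  ∀ c : γ, IndepFun A B (cond μ (C ⁻¹' {c}))

/-- For every node `i` and every `n`, the variable `X_{i;[n]}` is independent of the non-parent
non-descendants over `[n]` together with the non-descendants at the next sample, given
`PA_{i;[n]}`. -/
def CausalIndependence (μ : Measure Ω) (X : Fin d → ℕ → Ω → Bool) (G : Digraph (Fin d)) : Prop :=
  ∀ (i : Fin d) (n : ℕ),
    CondIndepGiven μ
      (fun ω (m : Fin n) => X i m ω)
      (fun ω => (block X (nonParentNonDescendants G i) n ω, sample X (nonDescendants G i) n ω))
      (block X (parents G i) n)

/-- For every node with at least two parents, it happens with positive probability that every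
value which the tuple of the parents takes with positive probability in one sample (the choice of
sample `0` is immaterial under exchangeability) occurs somewhere in the sequence. -/
def SeesAllParentValues (μ : Measure Ω) (X : Fin d → ℕ → Ω → Bool) (G : Digraph (Fin d)) : Prop :=
  ∀ i : Fin d, 2 ≤ (parents G i).ncard →
    μ {ω | ∀ a : parents G i → Bool,
      μ {ω' | sample X (parents G i) 0 ω' = a} ≠ 0 → ∃ n, sample X (parents G i) n ω = a} ≠ 0

end Sequences

/-! ### The latent parameters -/

section Parameters

variable {d : ℕ}

/-- The space `[0, 1]^{2^{|PA_i|}}` of the parameter `θ_i`: one number in `[0, 1]` for each of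
the binary assignments to the parents of `i`. -/
abbrev Param (G : Digraph (Fin d)) (i : Fin d) : Type :=
  (parents G i → Bool) → unitInterval

/-- `p(b | a, θ_i)`: the probability of `b` under the Bernoulli law with success probability
`θ_i(a)`, where `a` is the assignment to the parents of `i`. -/
def mechanism {G : Digraph (Fin d)} {i : Fin d} (θ : Param G i) (a : parents G i → Bool)
    (b : Bool) : ℝ :=
  (bernoulliMeasure true false (θ a)).real {b}

end Parameters

end CausalDeFinetti

end

noncomputable section

namespace CausalDeFinetti

/-! ### The multivariate Hausdorff moment problem -/

section Moment

open Filter Topology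

/-! Fix a node `i`, regard the parent values as labels and the values of `i` as outcomes.
Exchangeability makes the probability of a finite pattern depend only on its multiset of entries
(`boxProb`). Let `h` be the law of a multiset of labels and `g` that of labels with outcomes. The
next-sample part of causal independence says that the parents in sample `n + 1` tell nothing new
about `X_{i;[n]}` given the past parents; hence the quotient `g / h` is additive over the outcome of
an added label. A nonnegative normalized function with this additivity is a family of mixed moments
on a cube (`exists_measure_integral_weights`, by Bernstein polynomials and compactness), and the
resulting measure is `ν i`.

The quotient makes sense only where `h > 0`. Recurrence (`boxProb_add_self_pos`) gives arbitrary
multiplicities to the labels of any multiset of positive probability. If one such multiset contains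
every label that can occur, all moments are available at once. This is what the third hypothesis
supplies; without it the laws obtained on different sets of labels would have to be glued. With at
most one parent there are at most two labels: either both can be seen together, or only constant
patterns have positive probability and a product measure suffices (`exists_measure_of_labels`).

The same-sample part of causal independence yields the chain rule
`measureReal_eq_prod_of_ancestral`: the joint probability is a product over nodes of integrals,
which is one integral against the product of the `ν i`. -/

/-- The Bernoulli weight of the outcome `b`, with success parameter `t` in any ring. -/
def weight {R : Type*} [Ring R] (t : R) (b : Bool) : R := bif b then t else 1 - t

lemma map_weight {R S : Type*} [Ring R] [Ring S] (φ : R →+* S) (t : R) (b : Bool) :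
    φ (weight t b) = weight (φ t) b := by
  cases b <;> simp [weight]

/-- The identity `C(N,k) C(k,s) = C(N,s) C(N-s,k-s)` reduces the sum to the binomial expansion of
`(x + (1 - x)) ^ (N - s)`. It expands `x ^ s` in the Bernstein basis of degree `N`. -/
lemma sum_choose_mul_choose {R : Type*} [CommRing R] (x : R) {N s : ℕ} (h : s ≤ N) :
    ∑ k ∈ Finset.range (N + 1), ((N.choose k * k.choose s : ℕ) : R) * (x ^ k * (1 - x) ^ (N - k)) =
      (N.choose s : R) * x ^ s := by
  obtain ⟨m, rfl⟩ := Nat.exists_eq_add_of_le h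
  rw [add_assoc, Finset.sum_range_add, Finset.sum_eq_zero, zero_add]
  · have hone : (x + (1 - x)) ^ m = 1 := by rw [add_sub_cancel, one_pow]
    rw [add_pow] at hone
    calc _ = ((s + m).choose s : R) * x ^ s *
          ∑ k ∈ Finset.range (m + 1), x ^ k * (1 - x) ^ (m - k) * (m.choose k : R) := by
          rw [Finset.mul_sum]
          refine Finset.sum_congr rfl fun k hk => ?_
          have hk' : k ≤ m := by simpa [Nat.lt_succ_iff] using hk
          rw [Nat.choose_mul (Nat.le_add_right _ _), Nat.add_sub_cancel_left,
            Nat.add_sub_cancel_left, Nat.add_sub_add_left]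
          push_cast
          ring
      _ = _ := by rw [hone, mul_one]
  · intro k hk
    rw [Nat.choose_eq_zero_of_lt (Finset.mem_range.1 hk)]
    simp

/-- Sampling without and with replacement: the quotient is the product of the factors `(k - j) / (N
- j)` for `j < s`, each within `j / (N - j)` of `k / N`. For fixed `s` the bound tends to zero
uniformly in `k`. -/
lemma abs_choose_div_choose_sub_pow_le {N k : ℕ} (hk : k ≤ N) (s : ℕ) (hs : s < N) :
    |(k.choose s : ℝ) / N.choose s - ((k : ℝ) / N) ^ s| ≤ s * (s / (N - s)) := by
  induction s with
  | zero => simp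
  | succ s ih =>
    have hs' : s < N := by omega
    have hN : (0 : ℝ) < N := by exact_mod_cast (by omega : 0 < N)
    have hNs : (0 : ℝ) < N - (s + 1) := by
      have : ((s + 1 : ℕ) : ℝ) < N := by exact_mod_cast hs
      push_cast at this; linarith
    have hNs' : (0 : ℝ) < N - s := by linarith
    have hkN : (k : ℝ) ≤ N := by exact_mod_cast hk
    have hs0 : (0 : ℝ) ≤ s := by positivity
    have hrec : ∀ n : ℕ, (n.choose (s + 1) : ℝ) * (s + 1) = n.choose s * (n - s) := by
      intro n
      rcases le_or_gt s n with h | h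
      · have := Nat.choose_succ_right_eq n s
        rw [← Nat.cast_sub h]
        exact_mod_cast this
      · rw [Nat.choose_eq_zero_of_lt h, Nat.choose_eq_zero_of_lt (by omega)]; simp
    have hc : (0 : ℝ) < N.choose s := by exact_mod_cast Nat.choose_pos hs'.le
    have hc' : (0 : ℝ) < N.choose (s + 1) := by exact_mod_cast Nat.choose_pos hs.le
    have hq : (k.choose (s + 1) : ℝ) / N.choose (s + 1) =
        (k.choose s : ℝ) / N.choose s * ((k - s) / (N - s)) := by
      have h1 := hrec k
      have h2 := hrec N
      rw [div_mul_div_comm, div_eq_div_iff hc'.ne' (by positivity), ← h1, ← h2]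
      ring
    set q := (k.choose s : ℝ) / N.choose s
    have hq0 : 0 ≤ q := by positivity
    have hq1 : q ≤ 1 := by
      refine (div_le_one hc).2 ?_
      exact_mod_cast Nat.choose_le_choose s hk
    set x := (k : ℝ) / N with hx
    have hx0 : 0 ≤ x := by positivity
    have hx1 : x ≤ 1 := (div_le_one hN).2 hkN
    have hd : |((k : ℝ) - s) / (N - s) - x| ≤ s / (N - s) := by
      have : ((k : ℝ) - s) / (N - s) - x = -(s / (N - s) * (1 - x)) := by
        rw [hx]; field_simp; ring
      rw [this, abs_neg, abs_of_nonneg (by have := sub_nonneg.2 hx1; positivity)]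
      exact mul_le_of_le_one_right (by positivity) (by linarith)
    have ih' := ih hs'
    have hle : (s : ℝ) / (N - s) ≤ (s + 1) / (N - (s + 1)) :=
      div_le_div₀ (by positivity) (by linarith) hNs (by linarith)
    rw [hq, pow_succ]
    calc |q * (((k : ℝ) - s) / (N - s)) - x ^ s * x|
        = |q * (((k : ℝ) - s) / (N - s) - x) + (q - x ^ s) * x| := by ring_nf
      _ ≤ q * |((k : ℝ) - s) / (N - s) - x| + |q - x ^ s| * x := by
          refine (abs_add_le _ _).trans ?_
          rw [abs_mul, abs_mul, abs_of_nonneg hq0, abs_of_nonneg hx0]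
      _ ≤ 1 * (s / (N - s)) + (s * (s / (N - s))) * 1 := by gcongr
      _ = (s + 1) * (s / (N - s)) := by ring
      _ ≤ _ := by push_cast; gcongr

lemma abs_prod_sub_prod_le {ι : Type*} (t : Finset ι) (u v : ι → ℝ)
    (hu : ∀ i, |u i| ≤ 1) (hv : ∀ i, |v i| ≤ 1) :
    |∏ i ∈ t, u i - ∏ i ∈ t, v i| ≤ ∑ i ∈ t, |u i - v i| := by
  classical
  induction t using Finset.induction_on with
  | empty => simp
  | insert a t ha ih =>
    rw [Finset.prod_insert ha, Finset.prod_insert ha, Finset.sum_insert ha]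
    have h1 : |∏ i ∈ t, u i| ≤ 1 := by
      rw [Finset.abs_prod]; exact Finset.prod_le_one (fun _ _ => abs_nonneg _) fun i _ => hu i
    calc |u a * ∏ i ∈ t, u i - v a * ∏ i ∈ t, v i|
        = |(u a - v a) * ∏ i ∈ t, u i + v a * (∏ i ∈ t, u i - ∏ i ∈ t, v i)| := by ring_nf
      _ ≤ |u a - v a| * |∏ i ∈ t, u i| + |v a| * |∏ i ∈ t, u i - ∏ i ∈ t, v i| := by
          refine (abs_add_le _ _).trans ?_
          rw [abs_mul, abs_mul]
      _ ≤ |u a - v a| * 1 + 1 * ∑ i ∈ t, |u i - v i| := by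
          gcongr
          exact hv a
      _ = _ := by ring

variable {A : Type*}

/-- The product of the Bernoulli weights of the labelled outcomes in `M`. -/
def weights {R : Type*} [CommRing R] (t : A → R) (M : Multiset (A × Bool)) : R :=
  (M.map fun p => weight (t p.1) p.2).prod

@[simp] lemma weights_zero {R : Type*} [CommRing R] (t : A → R) : weights t 0 = 1 := by
  simp [weights]

@[simp] lemma weights_cons {R : Type*} [CommRing R] (t : A → R) (p : A × Bool)
    (M : Multiset (A × Bool)) : weights t (p ::ₘ M) = weight (t p.1) p.2 * weights t M := by
  simp [weights]

lemma weights_add {R : Type*} [CommRing R] (t : A → R) (M M' : Multiset (A × Bool)) :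
    weights t (M + M') = weights t M * weights t M' := by
  simp [weights]

lemma map_weights {R S : Type*} [CommRing R] [CommRing S] (φ : R →+* S) (t : A → R)
    (M : Multiset (A × Bool)) : φ (weights t M) = weights (fun a => φ (t a)) M := by
  simp [weights, map_multiset_prod, Multiset.map_map, map_weight]

lemma continuous_weights (M : Multiset (A × Bool)) :
    Continuous fun θ : A → unitInterval => weights (fun a => (θ a : ℝ)) M := by
  unfold weights
  refine continuous_multiset_prod M fun p _ => ?_
  rcases p with ⟨a, _ | _⟩ <;> simp only [weight, cond_true, cond_false] <;> fun_prop

/-- The linear functional on polynomials whose value at the products of the weights of the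
indeterminates is prescribed on the monomials. -/
def polyFunctional (f : Multiset (A × Bool) → ℝ) : MvPolynomial A ℝ →ₗ[ℝ] ℝ :=
  (MvPolynomial.basisMonomials A ℝ).constr ℝ fun s => f ((Finsupp.toMultiset s).map (·, true))

lemma weights_X_map_true [DecidableEq A] (m : Multiset A) :
    weights (MvPolynomial.X (R := ℝ)) (m.map (·, true)) =
      (MvPolynomial.basisMonomials A ℝ) (Multiset.toFinsupp m) := by
  rw [MvPolynomial.coe_basisMonomials]
  induction m using Multiset.induction_on with
  | empty => simp
  | cons a m ih =>
    rw [Multiset.map_cons, weights_cons, ih, ← Multiset.singleton_add, map_add,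
      Multiset.toFinsupp_singleton]
    simp [weight, MvPolynomial.X, MvPolynomial.monomial_mul]

/-- The functional is prescribed only on all-true patterns; additivity of `f` removes a false
outcome just as `1 - X` expands. The induction carries an extra all-true part `m`, which absorbs the
labels that change sides. -/
lemma polyFunctional_weights (f : Multiset (A × Bool) → ℝ)
    (hf : ∀ M a, f M = f ((a, true) ::ₘ M) + f ((a, false) ::ₘ M)) (M : Multiset (A × Bool)) :
    polyFunctional f (weights MvPolynomial.X M) = f M := by
  classical
  suffices h : ∀ (M : Multiset (A × Bool)) (m : Multiset A),
      polyFunctional f (weights MvPolynomial.X (M + m.map (·, true))) =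
        f (M + m.map (·, true)) by
    simpa using h M 0
  intro M
  induction M using Multiset.induction_on with
  | empty =>
    intro m
    rw [zero_add, weights_X_map_true, polyFunctional, Module.Basis.constr_basis]
    simp
  | cons p M ih =>
    intro m
    have htrue : ∀ a, polyFunctional f (weights MvPolynomial.X
        ((a, true) ::ₘ (M + m.map (·, true)))) = f ((a, true) ::ₘ (M + m.map (·, true))) := by
      intro a
      simpa using ih (a ::ₘ m)
    rcases p with ⟨a, _ | _⟩
    · have h1 := htrue a
      have h2 := hf (M + m.map (·, true)) a
      rw [Multiset.cons_add]
      rw [weights_cons] at h1 ⊢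
      simp only [weight, cond_true, cond_false, sub_mul, one_mul, map_sub] at h1 ⊢
      rw [h1, ih]
      linarith
    · rw [Multiset.cons_add]
      exact htrue a

variable [Fintype A]

/-- The Bernstein weight of the multi-index `k`, in the variables `t`. -/
def bernstein {R : Type*} [CommRing R] [Algebra ℝ R] (N : ℕ) (k : A → ℕ) (t : A → R) : R :=
  ∏ a, ((N.choose (k a) : ℝ) • (t a ^ k a * (1 - t a) ^ (N - k a)))

lemma bernstein_eq_smul_weights {R : Type*} [CommRing R] [Algebra ℝ R] (N : ℕ) (k : A → ℕ)
    (t : A → R) :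
    bernstein N k t = (∏ a, (N.choose (k a) : ℝ)) • weights t (∑ a,
      (Multiset.replicate (k a) (a, true) + Multiset.replicate (N - k a) (a, false))) := by
  have : ∀ s : Finset A, weights t (∑ a ∈ s,
      (Multiset.replicate (k a) (a, true) + Multiset.replicate (N - k a) (a, false))) =
      ∏ a ∈ s, (t a ^ k a * (1 - t a) ^ (N - k a)) := by
    classical
    intro s
    induction s using Finset.induction_on with
    | empty => simp
    | insert a s ha ih =>
      rw [Finset.sum_insert ha, Finset.prod_insert ha, weights_add, ih, weights_add]
      simp [weights, weight]
  rw [this, bernstein, Finset.prod_smul]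

lemma prod_pow_eq_sum_bernstein [DecidableEq A] {R : Type*} [CommRing R] [Algebra ℝ R] (t : A → R) {N : ℕ}
    (s : A → ℕ) (hs : ∀ a, s a ≤ N) :
    ∏ a, t a ^ s a = ∑ k ∈ Fintype.piFinset fun _ : A => Finset.range (N + 1),
      (∏ a, ((k a).choose (s a) : ℝ) / N.choose (s a)) • bernstein N k t := by
  have h1 : ∀ a, t a ^ s a = ∑ k ∈ Finset.range (N + 1),
      (((k.choose (s a) : ℝ) / N.choose (s a)) •
        ((N.choose k : ℝ) • (t a ^ k * (1 - t a) ^ (N - k)))) := by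
    intro a
    have hc : (N.choose (s a) : ℝ) ≠ 0 := by exact_mod_cast (Nat.choose_pos (hs a)).ne'
    have := sum_choose_mul_choose (t a) (hs a)
    rw [← inv_smul_smul₀ hc (t a ^ s a), Algebra.smul_def (N.choose (s a) : ℝ), map_natCast,
      ← this, Finset.smul_sum]
    refine Finset.sum_congr rfl fun k _ => ?_
    rw [smul_smul, ← map_natCast (algebraMap ℝ R), ← Algebra.smul_def, smul_smul]
    congr 1
    push_cast
    field_simp
  simp_rw [bernstein, ← Finset.prod_smul]
  rw [Finset.prod_congr rfl fun a _ => h1 a, Finset.prod_univ_sum]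

/-- **Multivariate Hausdorff moment problem**: a nonnegative normalized function of finite
collections of labelled outcomes that is additive over the outcome of an added label is
the family of the mixed moments of a random point of the cube. -/
theorem exists_measure_integral_weights (f : Multiset (A × Bool) → ℝ) (h0 : f 0 = 1)
    (hnn : ∀ M, 0 ≤ f M)
    (hf : ∀ M a, f M = f ((a, true) ::ₘ M) + f ((a, false) ::ₘ M)) :
    ∃ ν : Measure (A → unitInterval), IsProbabilityMeasure ν ∧
      ∀ M, ∫ θ, weights (fun a => (θ a : ℝ)) M ∂ν = f M := by
  classical
  set L := polyFunctional f with hL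
  set K : ℕ → Finset (A → ℕ) := fun N => Fintype.piFinset fun _ : A => Finset.range (N + 1)
  -- These become the masses of a discrete measure on the grid of points `k / N`. They are
  -- nonnegative because a Bernstein polynomial is a positive multiple of a product of weights,
  -- where `L` takes a value of `f`.
  set w : ℕ → (A → ℕ) → ℝ := fun N k => L (bernstein N k MvPolynomial.X)
  have hw : ∀ N k, 0 ≤ w N k := by
    intro N k
    simp only [w]
    rw [bernstein_eq_smul_weights, map_smul, polyFunctional_weights f hf]
    exact mul_nonneg (by positivity) (hnn _)
  have hLpow : ∀ (s : A → ℕ) (N : ℕ), (∀ a, s a ≤ N) → L (∏ a, MvPolynomial.X a ^ s a) =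
      ∑ k ∈ K N, w N k * ∏ a, ((k a).choose (s a) : ℝ) / N.choose (s a) := by
    intro s N hs
    rw [prod_pow_eq_sum_bernstein _ s hs, map_sum]
    exact Finset.sum_congr rfl fun k _ => by rw [map_smul, smul_eq_mul, mul_comm]
  have hL1 : L 1 = 1 := by
    have := polyFunctional_weights f hf 0
    rwa [weights_zero, h0] at this
  have hw1 : ∀ N, ∑ k ∈ K N, w N k = 1 := by
    intro N
    have := hLpow 0 N (by simp)
    simpa [hL1] using this.symm
  set pt : ℕ → (A → ℕ) → (A → unitInterval) := fun N k a =>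
    Set.projIcc (0 : ℝ) 1 zero_le_one ((k a : ℝ) / N)
  have hpt : ∀ N, 0 < N → ∀ k ∈ K N, ∀ a, (pt N k a : ℝ) = (k a : ℝ) / N := by
    intro N hN k hk a
    have hka : k a ≤ N := by
      have := Fintype.mem_piFinset.1 hk a
      simpa [Nat.lt_succ_iff] using this
    have : ((k a : ℝ) / N) ∈ Set.Icc (0 : ℝ) 1 :=
      ⟨by positivity, (div_le_one (by exact_mod_cast hN)).2 (by exact_mod_cast hka)⟩
    simp only [pt]
    rw [Set.projIcc_of_mem _ this]
  set m : ℕ → Measure (A → unitInterval) := fun N =>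
    ∑ k ∈ K N, ENNReal.ofReal (w N k) • Measure.dirac (pt N k)
  have hm : ∀ N, IsProbabilityMeasure (m N) := by
    intro N
    constructor
    simp only [m, Measure.coe_finsetSum, Finset.sum_apply, Measure.smul_apply, smul_eq_mul,
      measure_univ, mul_one]
    rw [← ENNReal.ofReal_sum_of_nonneg fun k _ => hw N k, hw1, ENNReal.ofReal_one]
  have hint : ∀ N (g : (A → unitInterval) → ℝ),
      ∫ θ, g θ ∂(m N) = ∑ k ∈ K N, w N k * g (pt N k) := by
    intro N g
    simp only [m]
    rw [integral_finsetSum_measure]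
    · refine Finset.sum_congr rfl fun k _ => ?_
      rw [integral_smul_measure, integral_dirac, ENNReal.toReal_ofReal (hw N k), smul_eq_mul]
    · intro k _
      exact (integrable_dirac (by simp)).smul_measure ENNReal.ofReal_ne_top
  have hbound : ∀ (s : A → ℕ) (N : ℕ), (∀ a, s a < N) → 0 < N →
      |∫ θ, ∏ a, (θ a : ℝ) ^ s a ∂(m N) - L (∏ a, MvPolynomial.X a ^ s a)| ≤
        ∑ a, (s a * (s a / (N - s a)) : ℝ) := by
    intro s N hs hN
    rw [hint, hLpow s N fun a => (hs a).le, ← Finset.sum_sub_distrib]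
    calc |∑ k ∈ K N, (w N k * ∏ a, (pt N k a : ℝ) ^ s a -
            w N k * ∏ a, ((k a).choose (s a) : ℝ) / N.choose (s a))|
        ≤ ∑ k ∈ K N, w N k * ∑ a, (s a * (s a / (N - s a)) : ℝ) := by
          refine (Finset.abs_sum_le_sum_abs _ _).trans (Finset.sum_le_sum fun k hk => ?_)
          have hka : ∀ a, k a ≤ N := fun a => by
            have := Fintype.mem_piFinset.1 hk a
            simpa [Nat.lt_succ_iff] using this
          rw [← mul_sub, abs_mul, abs_of_nonneg (hw N k)]
          refine mul_le_mul_of_nonneg_left ?_ (hw N k)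
          refine (abs_prod_sub_prod_le _ _ _ (fun a => ?_) fun a => ?_).trans
            (Finset.sum_le_sum fun a _ => ?_)
          · rw [abs_of_nonneg (pow_nonneg (pt N k a).2.1 _)]
            exact pow_le_one₀ (pt N k a).2.1 (pt N k a).2.2
          · rw [abs_of_nonneg (by positivity)]
            refine div_le_one_of_le₀ ?_ (by positivity)
            exact_mod_cast Nat.choose_le_choose _ (hka a)
          · rw [hpt N hN k hk, abs_sub_comm]
            exact abs_choose_div_choose_sub_pow_le (hka a) _ (hs a)
      _ = _ := by rw [← Finset.sum_mul, hw1, one_mul]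
  have hlim : ∀ s : A → ℕ, Tendsto (fun N => ∫ θ, ∏ a, (θ a : ℝ) ^ s a ∂(m N)) atTop
      (𝓝 (L (∏ a, MvPolynomial.X a ^ s a))) := by
    intro s
    rw [tendsto_iff_norm_sub_tendsto_zero]
    have hz : Tendsto (fun N : ℕ => ∑ a, (s a * (s a / (N - s a)) : ℝ)) atTop (𝓝 0) := by
      rw [← Finset.sum_const_zero (s := (Finset.univ : Finset A))]
      refine tendsto_finsetSum _ fun a _ => ?_
      rw [← mul_zero (s a : ℝ)]
      refine Tendsto.const_mul _ (Tendsto.div_atTop tendsto_const_nhds ?_)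
      exact tendsto_atTop_add_const_right _ _ tendsto_natCast_atTop_atTop
    refine squeeze_zero' (Eventually.of_forall fun _ => norm_nonneg _) ?_ hz
    filter_upwards [eventually_gt_atTop (∑ a, s a)] with N hN
    exact hbound s N (fun a => (Finset.single_le_sum (fun _ _ => Nat.zero_le _)
      (Finset.mem_univ a)).trans_lt hN) (by omega)
  set P : ℕ → ProbabilityMeasure (A → unitInterval) := fun N => ⟨m N, hm N⟩
  -- Probability measures on the compact cube form a compact space, so a limit along an ultrafilter
  -- exists; it has the limiting moments.
  obtain ⟨ν, -, hν⟩ := isCompact_univ.ultrafilter_le_nhds ((hyperfilter ℕ : Ultrafilter ℕ).map P)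
    (by simp)
  have hνt : Tendsto P (hyperfilter ℕ : Filter ℕ) (𝓝 ν) := hν
  rw [ProbabilityMeasure.tendsto_iff_forall_integral_tendsto] at hνt
  have hmom : ∀ s : A → ℕ, ∫ θ, ∏ a, (θ a : ℝ) ^ s a ∂(ν : Measure (A → unitInterval)) =
      L (∏ a, MvPolynomial.X a ^ s a) := by
    intro s
    have hc : Continuous fun θ : A → unitInterval => ∏ a, (θ a : ℝ) ^ s a := by fun_prop
    exact tendsto_nhds_unique (hνt (BoundedContinuousFunction.mkOfCompact ⟨_, hc⟩))
      ((hlim s).mono_left (Nat.hyperfilter_le_atTop))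
  refine ⟨ν, inferInstance, fun M => ?_⟩
  have hcont : ∀ p : MvPolynomial A ℝ,
      Continuous fun θ : A → unitInterval => MvPolynomial.eval (fun a => (θ a : ℝ)) p := by
    intro p
    exact (MvPolynomial.continuous_eval p).comp (by fun_prop)
  have hintegrable : ∀ p : MvPolynomial A ℝ, Integrable (fun θ : A → unitInterval =>
      MvPolynomial.eval (fun a => (θ a : ℝ)) p) (ν : Measure (A → unitInterval)) := fun p =>
    (BoundedContinuousFunction.mkOfCompact ⟨_, hcont p⟩).integrable _
  have hpoly : ∀ p : MvPolynomial A ℝ, ∫ θ, MvPolynomial.eval (fun a => (θ a : ℝ)) p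
      ∂(ν : Measure (A → unitInterval)) = L p := by
    intro p
    induction p using MvPolynomial.induction_on' with
    | monomial s c =>
      simp only [MvPolynomial.eval_monomial]
      rw [integral_const_mul]
      simp only [Finsupp.prod_fintype _ _ fun _ => pow_zero _]
      rw [hmom, MvPolynomial.monomial_eq, Finsupp.prod_fintype _ _ fun _ => pow_zero _,
        ← MvPolynomial.smul_eq_C_mul, map_smul, smul_eq_mul]
    | add p q hp hq =>
      simp only [map_add]
      rw [integral_add (hintegrable p) (hintegrable q), hp, hq]
  have := hpoly (weights MvPolynomial.X M)
  rw [polyFunctional_weights f hf] at this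
  rw [← this]
  simp only [map_weights, MvPolynomial.eval_X]

end Moment

/-! ### Random parameters representing conditional laws of labelled outcomes -/

section Extension

variable {A : Type*} [Fintype A] {h : Multiset A → ℝ} {g : Multiset (A × Bool) → ℝ}

/-- On labels in `B` the quotient `g / h` is defined and `hrec` is its additivity. Labels outside
`B` receive the parameter zero: their outcome true has weight zero and their outcome false is
dropped, which makes the function total and keeps it additive. -/
lemma exists_measure_of_pos_on (h0 : h 0 = 1) (g0 : g 0 = 1) (hg : ∀ M, 0 ≤ g M)
    (hrec : ∀ a M, (g ((a, true) ::ₘ M) + g ((a, false) ::ₘ M)) * h (M.map Prod.fst) =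
      g M * h (a ::ₘ M.map Prod.fst))
    (B : Set A) (hB : ∀ m : Multiset A, (∀ a ∈ m, a ∈ B) → 0 < h m) :
    ∃ ν : Measure (A → unitInterval), IsProbabilityMeasure ν ∧
      ∀ M : Multiset (A × Bool), (∀ p ∈ M, p.1 ∈ B) →
        g M = h (M.map Prod.fst) * ∫ θ, weights (fun a => (θ a : ℝ)) M ∂ν := by
  classical
  have hpos : ∀ M : Multiset (A × Bool), 0 < h ((M.filter (·.1 ∈ B)).map Prod.fst) := by
    intro M
    apply hB
    intro a ha
    obtain ⟨p, hp, rfl⟩ := Multiset.mem_map.1 ha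
    exact (Multiset.mem_filter.1 hp).2
  obtain ⟨ν, hν, hνf⟩ := exists_measure_integral_weights (A := A)
    (fun M => if ∃ p ∈ M, p.1 ∉ B ∧ p.2 = true then 0 else
      g (M.filter (·.1 ∈ B)) / h ((M.filter (·.1 ∈ B)).map Prod.fst))
    (by simp [h0, g0])
    (fun M => by
      split_ifs
      exacts [le_rfl, div_nonneg (hg _) (hpos M).le])
    (fun M a => by
      by_cases ha : a ∈ B
      · have hex : ∀ b, (∃ p ∈ (a, b) ::ₘ M, p.1 ∉ B ∧ p.2 = true) ↔
            ∃ p ∈ M, p.1 ∉ B ∧ p.2 = true := fun b => by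
          simp [or_and_right, exists_or, ha]
        have h1 := hrec a (M.filter (·.1 ∈ B))
        have h2 := hpos ((a, true) ::ₘ M)
        simp only [Multiset.filter_cons_of_pos M (p := fun p : A × Bool => p.1 ∈ B)
          (a := (a, true)) ha, Multiset.filter_cons_of_pos M (p := fun p : A × Bool => p.1 ∈ B)
          (a := (a, false)) ha, Multiset.map_cons, hex] at h2 ⊢
        split_ifs
        · simp
        · rw [← add_div, div_eq_div_iff (hpos M).ne' h2.ne', h1]
      · simp [ha])
  refine ⟨ν, hν, fun M hM => ?_⟩
  have hfilter : M.filter (·.1 ∈ B) = M := Multiset.filter_eq_self.2 hM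
  have hM' : ¬ ∃ p ∈ M, p.1 ∉ B ∧ p.2 = true := fun ⟨p, hp, hp', _⟩ => hp' (hM p hp)
  have h2 := hpos M
  rw [hfilter] at h2
  rw [hνf, if_neg hM', hfilter, mul_div_cancel₀ _ h2.ne']

/-- Repeated doubling makes `2 ^ j • m₀` positive for all `j`, and for `j = card m` this multiset
contains `m`. -/
lemma pos_of_forall_mem {A : Type*} {h : Multiset A → ℝ} (hmono : ∀ m m', m ≤ m' → h m' ≤ h m)
    (hdbl : ∀ m, 0 < h m → 0 < h (m + m)) {m₀ m : Multiset A} (hm₀ : 0 < h m₀)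
    (hm : ∀ a ∈ m, a ∈ m₀) : 0 < h m := by
  classical
  have hpow : ∀ j : ℕ, 0 < h (2 ^ j • m₀) := by
    intro j
    induction j with
    | zero => simpa
    | succ j ih =>
      rw [pow_succ, mul_two, add_smul]
      exact hdbl _ ih
  refine (hpow (Multiset.card m)).trans_le (hmono _ _ (Multiset.le_iff_count.2 fun a => ?_))
  rw [Multiset.count_nsmul]
  by_cases ha : a ∈ m
  · calc m.count a ≤ Multiset.card m := Multiset.count_le_card a m
      _ ≤ 2 ^ Multiset.card m := Nat.lt_two_pow_self.le
      _ ≤ _ := Nat.le_mul_of_pos_right _ (Multiset.count_pos.2 (hm a ha))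
  · simp [Multiset.count_eq_zero_of_notMem ha]

/-- `h` is the law of the labels and `g` the joint law of the labels and their outcomes. -/
theorem exists_measure_of_labels (h0 : h 0 = 1) (g0 : g 0 = 1) (hg : ∀ M, 0 ≤ g M)
    (hrec : ∀ a M, (g ((a, true) ::ₘ M) + g ((a, false) ::ₘ M)) * h (M.map Prod.fst) =
      g M * h (a ::ₘ M.map Prod.fst))
    (hmono : ∀ m m', m ≤ m' → h m' ≤ h m)
    (hdbl : ∀ m, 0 < h m → 0 < h (m + m))
    (hcover : (∃ m, 0 < h m ∧ ∀ a, 0 < h {a} → a ∈ m) ∨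
      ∀ (a : A) (m : Multiset A), a ∉ m → ∃ b, ∀ x ∈ m, x = b) :
    ∃ ν : Measure (A → unitInterval), IsProbabilityMeasure ν ∧
      ∀ M : Multiset (A × Bool), 0 < h (M.map Prod.fst) →
        g M = h (M.map Prod.fst) * ∫ θ, weights (fun a => (θ a : ℝ)) M ∂ν := by
  classical
  by_cases hfull : ∃ m, 0 < h m ∧ ∀ a, 0 < h {a} → a ∈ m
  · obtain ⟨m₀, hm₀, hcov⟩ := hfull
    obtain ⟨ν, hν, hνg⟩ := exists_measure_of_pos_on h0 g0 hg hrec {a | 0 < h {a}} fun m hm =>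
      pos_of_forall_mem hmono hdbl hm₀ fun a ha => hcov a (hm a ha)
    exact ⟨ν, hν, fun M hM => hνg M fun p hp => hM.trans_le (hmono _ _
      (Multiset.singleton_le.2 (Multiset.mem_map_of_mem _ hp)))⟩
  -- A multiset of positive probability must miss some label, as otherwise it would be a full cover;
  -- so it is constant.
  · have hconst : ∀ m, 0 < h m → ∃ b, ∀ x ∈ m, x = b := by
      intro m hm
      by_cases hall : ∃ a, a ∉ m
      · obtain ⟨a, ha⟩ := hall
        exact hcover.resolve_left hfull a m ha
      · push Not at hall
        exact absurd ⟨m, hm, fun a _ => hall a⟩ hfull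
    -- The set of admitted labels is empty when `h {a} = 0`, so that a measure is available for
    -- every label.
    have hsingle : ∀ a : A, ∃ ν : Measure (A → unitInterval), IsProbabilityMeasure ν ∧
        ∀ M : Multiset (A × Bool), (∀ p ∈ M, p.1 ∈ {x | x = a ∧ 0 < h {a}}) →
        g M = h (M.map Prod.fst) * ∫ θ, weights (fun a => (θ a : ℝ)) M ∂ν := by
      intro a
      refine exists_measure_of_pos_on h0 g0 hg hrec _ fun m hm => ?_
      by_cases ha : 0 < h {a}
      · exact pos_of_forall_mem hmono hdbl ha fun x hx => by simpa using (hm x hx).1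
      · have : m = 0 := Multiset.eq_zero_of_forall_notMem fun x hx => ha (hm x hx).2
        rw [this, h0]
        exact one_pos
    choose ν hν hνg using hsingle
    have hprob : ∀ a, IsProbabilityMeasure ((ν a).map fun θ => θ a) := fun a =>
      Measure.isProbabilityMeasure_map (measurable_pi_apply a).aemeasurable
    -- Each relevant integral involves one coordinate only, so any coupling of the one-dimensional
    -- marginals works; the product is chosen.
    refine ⟨Measure.pi fun a => (ν a).map fun θ => θ a, inferInstance, fun M hM => ?_⟩
    obtain ⟨b, hb⟩ := hconst _ hM
    have hb' : ∀ p ∈ M, p.1 = b := fun p hp => hb _ (Multiset.mem_map_of_mem _ hp)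
    rw [hνg b M fun p hp => ⟨hb' p hp, ?_⟩]
    · congr 1
      have hw : ∀ θ : A → unitInterval, weights (fun a => (θ a : ℝ)) M =
          weights (fun _ : A => ((θ b : unitInterval) : ℝ)) M := fun θ => by
        unfold weights
        exact congrArg _ (Multiset.map_congr rfl fun p hp => by rw [hb' p hp])
      have hc : Continuous fun t : unitInterval => weights (fun _ : A => (t : ℝ)) M :=
        (continuous_weights M).comp (by fun_prop : Continuous fun (t : unitInterval) (_ : A) => t)
      simp_rw [hw]
      rw [← integral_map (φ := fun θ : A → unitInterval => θ b)
          (f := fun t : unitInterval => weights (fun _ : A => (t : ℝ)) M)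
          (measurable_pi_apply b).aemeasurable hc.aestronglyMeasurable,
        ← (measurePreserving_eval (fun a => (ν a).map fun θ => θ a) b).map_eq,
        integral_map (measurable_pi_apply b).aemeasurable hc.aestronglyMeasurable]
    · refine hM.trans_le (hmono _ _ (Multiset.singleton_le.2 ?_))
      rw [← hb' p hp]
      exact Multiset.mem_map_of_mem _ hp

end Extension

lemma exists_equiv_of_map_univ_eq {ι κ α : Type*} [Fintype ι] [Fintype κ] {S : ι → α} {T : κ → α}
    (h : Finset.univ.val.map S = Finset.univ.val.map T) :
    ∃ σ : κ ≃ ι, ∀ k, S (σ k) = T k := by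
  classical
  have hfib : ∀ c, Nonempty ({k // T k = c} ≃ {i // S i = c}) := by
    intro c
    rw [← Fintype.card_eq, Fintype.card_subtype, Fintype.card_subtype]
    have := congrArg (Multiset.count c) h
    simp only [Multiset.count_map, eq_comm (a := c)] at this
    exact this.symm
  exact ⟨Equiv.ofFiberEquiv fun c => (hfib c).some, Equiv.ofFiberEquiv_map _⟩

/-! ### Exchangeable sequences of tuples -/

section Exchangeable

variable {Ω : Type*} {d : ℕ}

/-- The `n`-th tuple of the sequence. -/
def tuple (X : Fin d → ℕ → Ω → Bool) (n : ℕ) (ω : Ω) : Fin d → Bool := fun i => X i n ω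

variable [MeasurableSpace Ω]

lemma measurableSet_tuple {X : Fin d → ℕ → Ω → Bool} (hX : ∀ i n, Measurable (X i n)) (n : ℕ)
    (S : Set (Fin d → Bool)) : MeasurableSet {ω | tuple X n ω ∈ S} :=
  (measurable_pi_lambda (tuple X n) fun i => hX i n) (MeasurableSet.of_discrete (s := S))

/-- The probability that the first tuples lie in the sets of the multiset `M`, in some order. -/
def boxProb (μ : Measure Ω) (X : Fin d → ℕ → Ω → Bool) (M : Multiset (Set (Fin d → Bool))) : ℝ :=
  μ.real {ω | ∀ k : Fin M.toList.length, tuple X k ω ∈ M.toList.get k}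

variable {μ : Measure Ω} {X : Fin d → ℕ → Ω → Bool}

lemma InfinitelyExchangeable.measure_perm (hX : ∀ i n, Measurable (X i n))
    (hexch : InfinitelyExchangeable μ X) {N : ℕ} (π : Equiv.Perm (Fin N))
    (S : Fin N → Set (Fin d → Bool)) :
    μ {ω | ∀ m, tuple X (π m) ω ∈ S m} = μ {ω | ∀ m : Fin N, tuple X m ω ∈ S m} := by
  have h := congrArg (fun ρ => ρ {z : Fin N → Fin d → Bool | ∀ m, z m ∈ S m}) (hexch N π)
  have hm : ∀ e : Fin N → ℕ, Measurable fun ω (m : Fin N) (i : Fin d) => X i (e m) ω := fun e =>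
    measurable_pi_lambda _ fun m => measurable_pi_lambda _ fun i => hX i (e m)
  rw [Measure.map_apply (hm fun m => π m) MeasurableSet.of_discrete,
    Measure.map_apply (hm fun m => m) MeasurableSet.of_discrete] at h
  exact h

/-- The injection extends to a permutation of a large enough `Fin N`, and the samples beyond the
first `n` are left unconstrained. -/
lemma InfinitelyExchangeable.measure_injective (hX : ∀ i n, Measurable (X i n))
    (hexch : InfinitelyExchangeable μ X) {n : ℕ} {e : Fin n → ℕ} (he : Function.Injective e)
    (S : Fin n → Set (Fin d → Bool)) :
    μ {ω | ∀ k, tuple X (e k) ω ∈ S k} = μ {ω | ∀ k : Fin n, tuple X k ω ∈ S k} := by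
  classical
  obtain ⟨N, hnN, hN⟩ : ∃ N, n ≤ N ∧ ∀ k, e k < N :=
    ⟨n + ∑ k, (e k + 1), by omega, fun k => by
      have := Finset.single_le_sum (f := fun k => e k + 1) (fun _ _ => Nat.zero_le _)
        (Finset.mem_univ k)
      omega⟩
  obtain ⟨π, hπ⟩ : ∃ π : Equiv.Perm (Fin N), ∀ k : Fin n, π (Fin.castLE hnN k) = ⟨e k, hN k⟩ := by
    have h1 : Function.Injective (Fin.castLE hnN) := Fin.castLE_injective hnN
    have h2 : Function.Injective fun k : Fin n => (⟨e k, hN k⟩ : Fin N) := fun a b hab =>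
      he (by simpa using hab)
    refine ⟨((Equiv.ofInjective _ h1).symm.trans (Equiv.ofInjective _ h2)).extendSubtype,
      fun k => ?_⟩
    rw [Equiv.extendSubtype_apply_of_mem _ _ ⟨k, rfl⟩]
    simp [Equiv.ofInjective_symm_apply h1]
  have h := hexch.measure_perm hX π
    (fun m => if hm : (m : ℕ) < n then S ⟨m, hm⟩ else Set.univ)
  convert h using 3
  · ext ω
    refine ⟨fun hω m => ?_, fun hω k => ?_⟩
    · split_ifs with hm
      · have := hω ⟨m, hm⟩
        have h3 := hπ ⟨m, hm⟩
        simp only [Fin.castLE_mk, Fin.eta] at h3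
        rwa [h3]
      · trivial
    · have := hω (Fin.castLE hnN k)
      simpa [hπ] using this
  · ext ω
    refine ⟨fun hω m => ?_, fun hω k => ?_⟩
    · split_ifs with hm
      · exact hω ⟨m, hm⟩
      · trivial
    · have := hω (Fin.castLE hnN k)
      simpa using this

/-- This makes `boxProb` independent of the order chosen by `toList`, and of which distinct samples
carry the pattern. -/
lemma InfinitelyExchangeable.measure_eq_boxProb (hX : ∀ i n, Measurable (X i n))
    (hexch : InfinitelyExchangeable μ X) {ι : Type*} [Fintype ι] {e : ι → ℕ}
    (he : Function.Injective e) (S : ι → Set (Fin d → Bool)) :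
    μ.real {ω | ∀ k, tuple X (e k) ω ∈ S k} = boxProb μ X (Finset.univ.val.map S) := by
  set M := Finset.univ.val.map S with hM
  obtain ⟨σ, hσ⟩ : ∃ σ : Fin M.toList.length ≃ ι, ∀ j, S (σ j) = M.toList.get j := by
    apply exists_equiv_of_map_univ_eq
    rw [Fin.univ_val_map M.toList.get, List.ofFn_get, Multiset.coe_toList]
  unfold boxProb
  rw [measureReal_def, measureReal_def, ← hexch.measure_injective hX (he.comp σ.injective)]
  congr 2
  ext ω
  simp only [Set.mem_ofPred_eq, ← hσ, Function.comp_apply]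
  exact ⟨fun h j => h (σ j), fun h k => by simpa using h (σ.symm k)⟩


lemma exists_map_univ_eq {α : Type*} (M : Multiset α) :
    ∃ (n : ℕ) (T : Fin n → α), M = Finset.univ.val.map T :=
  ⟨M.toList.length, M.toList.get, by
    rw [Fin.univ_val_map M.toList.get, List.ofFn_get, Multiset.coe_toList]⟩

lemma boxProb_map_univ (hX : ∀ i n, Measurable (X i n)) (hexch : InfinitelyExchangeable μ X)
    {n : ℕ} (T : Fin n → Set (Fin d → Bool)) :
    boxProb μ X (Finset.univ.val.map T) = μ.real {ω | ∀ k : Fin n, tuple X k ω ∈ T k} :=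
  (hexch.measure_eq_boxProb hX Fin.val_injective T).symm

lemma boxProb_cons_map_univ (hX : ∀ i n, Measurable (X i n)) (hexch : InfinitelyExchangeable μ X)
    {n : ℕ} (S : Set (Fin d → Bool)) (T : Fin n → Set (Fin d → Bool)) :
    boxProb μ X (S ::ₘ Finset.univ.val.map T) =
      μ.real ({ω | ∀ k : Fin n, tuple X k ω ∈ T k} ∩ {ω | tuple X n ω ∈ S}) := by
  have h := boxProb_map_univ hX hexch (Fin.snoc T S : Fin (n + 1) → Set (Fin d → Bool))
  have hM : Finset.univ.val.map (Fin.snoc T S : Fin (n + 1) → Set (Fin d → Bool)) =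
      S ::ₘ Finset.univ.val.map T := by
    rw [Fin.univ_castSuccEmb, Finset.cons_val, Multiset.map_cons, Finset.map_val,
      Multiset.map_map]
    simp only [Fin.snoc_last, Function.comp_def, Fin.castSuccEmb_apply, Fin.snoc_castSucc]
  rw [hM] at h
  rw [h]
  congr 1
  ext ω
  simp [Fin.forall_fin_succ']

lemma boxProb_nonneg (M : Multiset (Set (Fin d → Bool))) : 0 ≤ boxProb μ X M :=
  measureReal_nonneg

variable [IsProbabilityMeasure μ]

lemma boxProb_zero (hX : ∀ i n, Measurable (X i n)) (hexch : InfinitelyExchangeable μ X) :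
    boxProb μ X 0 = 1 := by
  have := boxProb_map_univ hX hexch (fun k : Fin 0 => k.elim0)
  simpa using this

lemma boxProb_union_cons (hX : ∀ i n, Measurable (X i n)) (hexch : InfinitelyExchangeable μ X)
    {S S' : Set (Fin d → Bool)} (hS : Disjoint S S') (M : Multiset (Set (Fin d → Bool))) :
    boxProb μ X ((S ∪ S') ::ₘ M) = boxProb μ X (S ::ₘ M) + boxProb μ X (S' ::ₘ M) := by
  obtain ⟨n, T, rfl⟩ := exists_map_univ_eq M
  rw [boxProb_cons_map_univ hX hexch, boxProb_cons_map_univ hX hexch,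
    boxProb_cons_map_univ hX hexch]
  have hT : MeasurableSet {ω | ∀ k : Fin n, tuple X k ω ∈ T k} := by
    have : {ω | ∀ k : Fin n, tuple X k ω ∈ T k} = ⋂ k : Fin n, {ω | tuple X k ω ∈ T k} := by
      ext; simp
    rw [this]
    exact MeasurableSet.iInter fun k => measurableSet_tuple hX _ _
  rw [← measureReal_union _ (hT.inter (measurableSet_tuple hX _ _)), ← Set.inter_union_distrib_left]
  · rfl
  · refine Set.disjoint_left.2 fun ω h1 h2 => Set.disjoint_left.1 hS h1.2 h2.2

lemma boxProb_cons_le (hX : ∀ i n, Measurable (X i n)) (hexch : InfinitelyExchangeable μ X)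
    (S : Set (Fin d → Bool)) (M : Multiset (Set (Fin d → Bool))) :
    boxProb μ X (S ::ₘ M) ≤ boxProb μ X M := by
  obtain ⟨n, T, rfl⟩ := exists_map_univ_eq M
  rw [boxProb_cons_map_univ hX hexch, boxProb_map_univ hX hexch]
  exact measureReal_mono Set.inter_subset_left

lemma boxProb_mono (hX : ∀ i n, Measurable (X i n)) (hexch : InfinitelyExchangeable μ X)
    {M M' : Multiset (Set (Fin d → Bool))} (h : M ≤ M') :
    boxProb μ X M' ≤ boxProb μ X M := by
  obtain ⟨M'', rfl⟩ := Multiset.le_iff_exists_add.1 h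
  rw [add_comm]
  induction M'' using Multiset.induction_on with
  | empty => simp
  | cons S M'' ih =>
    rw [Multiset.cons_add]
    exact (boxProb_cons_le hX hexch S _).trans (ih (Multiset.le_add_right _ _))

/-- Recurrence: a pattern of positive probability occurs twice with positive probability. -/
lemma boxProb_add_self_pos (hX : ∀ i n, Measurable (X i n)) (hexch : InfinitelyExchangeable μ X)
    {M : Multiset (Set (Fin d → Bool))} (hM : 0 < boxProb μ X M) : 0 < boxProb μ X (M + M) := by
  obtain ⟨n, T, rfl⟩ := exists_map_univ_eq M
  by_contra hcon
  have hzero : boxProb μ X (Finset.univ.val.map T + Finset.univ.val.map T) = 0 :=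
    le_antisymm (not_lt.1 hcon) (boxProb_nonneg _)
  -- Cut time into consecutive blocks of length `n`. If the doubled pattern were null, the events
  -- that it occurs in the separate blocks would be almost disjoint with one common positive
  -- probability, which a finite measure excludes.
  set p : ℕ × Fin n → ℕ := fun bk => bk.1 * n + bk.2 with hp
  have hpinj : Function.Injective p := by
    rintro ⟨b, k⟩ ⟨b', k'⟩ h
    have hk := k.2
    have hk' := k'.2
    simp only [hp] at h
    have h1 : k.1 = k'.1 := by
      have := congrArg (· % n) h
      simpa [Nat.add_mod, Nat.mod_eq_of_lt hk, Nat.mod_eq_of_lt hk'] using this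
    have h2 : b = b' := Nat.eq_of_mul_eq_mul_right (by omega : 0 < n) (by omega)
    rw [h2, Fin.ext h1]
  set E : ℕ → Set Ω := fun b => {ω | ∀ k, tuple X (p (b, k)) ω ∈ T k} with hE
  have hEm : ∀ b, MeasurableSet (E b) := fun b => by
    have : E b = ⋂ k : Fin n, {ω | tuple X (p (b, k)) ω ∈ T k} := by
      ext; simp [hE]
    rw [this]
    exact MeasurableSet.iInter fun k => measurableSet_tuple hX _ _
  have hEp : ∀ b, μ.real (E b) = boxProb μ X (Finset.univ.val.map T) := fun b =>
    hexch.measure_eq_boxProb hX (e := fun k => p (b, k))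
      (fun k k' h => (Prod.ext_iff.1 (hpinj h)).2) T
  have hdisj : Pairwise (Function.onFun (AEDisjoint μ) E) := by
    intro b c hbc
    have h := hexch.measure_eq_boxProb hX (ι := Fin n ⊕ Fin n)
      (e := Sum.elim (fun k => p (b, k)) fun k => p (c, k)) (by
        rintro (k | k) (k' | k') h
        · exact congrArg _ (Prod.ext_iff.1 (hpinj h)).2
        · exact absurd (Prod.ext_iff.1 (hpinj h)).1 hbc
        · exact absurd (Prod.ext_iff.1 (hpinj h)).1.symm hbc
        · exact congrArg _ (Prod.ext_iff.1 (hpinj h)).2) (Sum.elim T T)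
    have hM : Finset.univ.val.map (Sum.elim T T) =
        Finset.univ.val.map T + Finset.univ.val.map T := by
      rw [← Finset.univ_disjSum_univ, Finset.val_disjSum, Multiset.disjSum, Multiset.map_add,
        Multiset.map_map, Multiset.map_map]
      rfl
    rw [hM, hzero, measureReal_eq_zero_iff] at h
    refine measure_mono_null (fun ω hω => ?_) h
    rintro (k | k)
    exacts [hω.1 k, hω.2 k]
  have hsum := measure_iUnion₀ hdisj fun b => (hEm b).nullMeasurableSet
  have hconst : ∀ b, μ (E b) = μ (E 0) := fun b => by
    rw [← ofReal_measureReal, ← ofReal_measureReal (s := E 0), hEp, hEp]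
  simp only [hconst] at hsum
  have hne : μ (E 0) ≠ 0 := by
    rw [← measureReal_ne_zero_iff, hEp]
    exact hM.ne'
  rw [ENNReal.tsum_const_eq_top_of_ne_zero hne] at hsum
  exact measure_ne_top _ _ hsum

end Exchangeable

/-! ### Causal independence -/

section Causal

variable {Ω : Type*} {d : ℕ}

/-- Clearing the denominators gives a form that stays true when the conditioning event is null. -/
lemma CondIndepGiven.measureReal_mul [MeasurableSpace Ω] {μ : Measure Ω} [IsFiniteMeasure μ]
    {α β γ : Type*} [MeasurableSpace α] [MeasurableSpace β] [Finite γ] {A : Ω → α} {B : Ω → β}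
    {C : Ω → γ} (h : CondIndepGiven μ A B C) {c : γ} (hC : MeasurableSet (C ⁻¹' {c}))
    {s : Set α} {t : Set β} (hs : MeasurableSet s) (ht : MeasurableSet t) :
    μ.real (C ⁻¹' {c} ∩ (A ⁻¹' s ∩ B ⁻¹' t)) * μ.real (C ⁻¹' {c}) =
      μ.real (C ⁻¹' {c} ∩ A ⁻¹' s) * μ.real (C ⁻¹' {c} ∩ B ⁻¹' t) := by
  by_cases h0 : μ.real (C ⁻¹' {c}) = 0
  · have : μ.real (C ⁻¹' {c} ∩ A ⁻¹' s) = 0 :=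
      le_antisymm (h0 ▸ measureReal_mono Set.inter_subset_left) measureReal_nonneg
    rw [h0, this, mul_zero, zero_mul]
  · have := congrArg ENNReal.toReal ((h c).measure_inter_preimage_eq_mul s t hs ht)
    simp only [cond_apply hC, ENNReal.toReal_mul, ENNReal.toReal_inv, ← measureReal_def] at this
    field_simp at this
    linarith

/-- The tuples whose parents of `i` take the value `a`. -/
def parentSet (G : Digraph (Fin d)) (i : Fin d) (a : parents G i → Bool) : Set (Fin d → Bool) :=
  {z | (fun j : parents G i => z j) = a}

/-- The tuples whose parents of `i` take the value `p.1`, and whose `i`-th entry is `p.2`. -/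
def familySet (G : Digraph (Fin d)) (i : Fin d) (p : (parents G i → Bool) × Bool) :
    Set (Fin d → Bool) :=
  {z | (fun j : parents G i => z j) = p.1 ∧ z i = p.2}

lemma familySet_union (G : Digraph (Fin d)) (i : Fin d) (a : parents G i → Bool) :
    familySet G i (a, true) ∪ familySet G i (a, false) = parentSet G i a := by
  ext z
  cases h : z i <;> simp [familySet, parentSet, h]

lemma disjoint_familySet (G : Digraph (Fin d)) (i : Fin d) (a : parents G i → Bool) :
    Disjoint (familySet G i (a, true)) (familySet G i (a, false)) :=
  Set.disjoint_left.2 fun _ h1 h2 => by simpa using h1.2.symm.trans h2.2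

lemma IsDAG.parents_subset_nonDescendants {G : Digraph (Fin d)} (hG : IsDAG G) (i : Fin d) :
    parents G i ⊆ nonDescendants G i := by
  intro j hj
  refine ⟨?_, fun h => hG i (h.tail hj)⟩
  rintro rfl
  exact hG j (.single hj)

variable [MeasurableSpace Ω] {μ : Measure Ω} [IsProbabilityMeasure μ] {X : Fin d → ℕ → Ω → Bool}
  {G : Digraph (Fin d)}

lemma measurable_block (hX : ∀ i n, Measurable (X i n)) (S : Set (Fin d)) (n : ℕ) :
    Measurable (block X S n) :=
  measurable_pi_lambda _ fun m => measurable_pi_lambda _ fun j => hX j m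

/-- Acyclicity puts the parents among the non-descendants, so the parents in the next sample are
independent of the past values of `i` given the past parents. This is the source of the additivity
of `g / h`. -/
lemma CausalIndependence.boxProb_parentSet_cons_mul (hX : ∀ i n, Measurable (X i n))
    (hexch : InfinitelyExchangeable μ X) (hG : IsDAG G) (hind : CausalIndependence μ X G)
    (i : Fin d) (a : parents G i → Bool) (M : Multiset ((parents G i → Bool) × Bool)) :
    boxProb μ X (parentSet G i a ::ₘ M.map (familySet G i)) *
        boxProb μ X ((M.map Prod.fst).map (parentSet G i)) =
      boxProb μ X (M.map (familySet G i)) *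
        boxProb μ X ((a ::ₘ M.map Prod.fst).map (parentSet G i)) := by
  obtain ⟨n, P, rfl⟩ := exists_map_univ_eq M
  have h := (hind i n).measureReal_mul (c := fun m => (P m).1)
    (measurable_block hX _ n (MeasurableSet.of_discrete (s := {fun m => (P m).1})))
    (s := {fun m => (P m).2})
    (t := {u | (fun j : parents G i => u.2 ⟨j, hG.parents_subset_nonDescendants i j.2⟩) = a})
    MeasurableSet.of_discrete MeasurableSet.of_discrete
  simp only [Multiset.map_cons, Multiset.map_map]
  rw [boxProb_cons_map_univ hX hexch, boxProb_cons_map_univ hX hexch, boxProb_map_univ hX hexch,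
    boxProb_map_univ hX hexch]
  convert h using 3
  · ext ω
    simp [familySet, parentSet, tuple, block, sample, funext_iff, forall_and]
    tauto
  · ext ω
    simp [parentSet, tuple, block, funext_iff]
  · ext ω
    simp [familySet, tuple, block, funext_iff, forall_and]
  · ext ω
    simp [parentSet, tuple, block, sample, funext_iff]

lemma exists_boxProb_pos_of_seesAllParentValues (hX : ∀ i n, Measurable (X i n))
    (hexch : InfinitelyExchangeable μ X) (hpos : SeesAllParentValues μ X G) {i : Fin d}
    (hi : 2 ≤ (parents G i).ncard) :
    ∃ m : Multiset (parents G i → Bool), 0 < boxProb μ X (m.map (parentSet G i)) ∧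
      ∀ a, 0 < boxProb μ X (({a} : Multiset (parents G i → Bool)).map (parentSet G i)) → a ∈ m := by
  have := Fintype.ofFinite (parents G i → Bool)
  by_contra! hcon
  -- Seeing every possible value happens within a finite prefix. There are countably many finite
  -- words containing all these values, and if no such word had positive probability the event would
  -- be null.
  refine hpos i hi (measure_mono_null (t := ⋃ (N : ℕ) (x : Fin N → parents G i → Bool)
    (_ : ∀ a, μ {ω | sample X (parents G i) 0 ω = a} ≠ 0 → ∃ k, x k = a),
    {ω | ∀ k : Fin N, tuple X k ω ∈ parentSet G i (x k)}) (fun ω hω => ?_) ?_)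
  · choose! n hn using hω
    simp only [Set.mem_iUnion]
    refine ⟨∑ a, (n a + 1), fun k => sample X (parents G i) k ω, fun a ha => ?_, fun k => rfl⟩
    have := Finset.single_le_sum (f := fun a => n a + 1) (fun _ _ => Nat.zero_le _)
      (Finset.mem_univ a)
    exact ⟨⟨n a, this⟩, hn a ha⟩
  · simp only [measure_iUnion_null_iff]
    intro N x hx
    by_contra hne
    obtain ⟨a, ha, ham⟩ := hcon (Finset.univ.val.map x) (by
      rw [Multiset.map_map, boxProb_map_univ hX hexch]
      exact (measureReal_nonneg).lt_of_ne' ((measureReal_ne_zero_iff).2 hne))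
    have ha' : {a} = (Finset.univ : Finset (Fin 1)).val.map fun _ => a := by simp
    rw [ha', Multiset.map_map, boxProb_map_univ hX hexch] at ha
    obtain ⟨k, hk⟩ := hx a fun h0 => ha.ne' (by
      rw [measureReal_eq_zero_iff]
      refine measure_mono_null (fun ω hω => ?_) h0
      exact hω 0)
    exact ham (Multiset.mem_map.2 ⟨k, Finset.mem_univ k, hk⟩)

/-- The conditional law of the node `i` given its parents is a mixture of Bernoulli mechanisms. -/
theorem exists_measure_mechanism (hX : ∀ i n, Measurable (X i n))
    (hexch : InfinitelyExchangeable μ X) (hG : IsDAG G) (hind : CausalIndependence μ X G)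
    (hpos : SeesAllParentValues μ X G) (i : Fin d) :
    ∃ ν : Measure (Param G i), IsProbabilityMeasure ν ∧
      ∀ M : Multiset ((parents G i → Bool) × Bool),
        0 < boxProb μ X ((M.map Prod.fst).map (parentSet G i)) →
        boxProb μ X (M.map (familySet G i)) =
          boxProb μ X ((M.map Prod.fst).map (parentSet G i)) *
            ∫ θ, weights (fun a => (θ a : ℝ)) M ∂ν := by
  have := Fintype.ofFinite (parents G i → Bool)
  refine exists_measure_of_labels (h := fun m => boxProb μ X (m.map (parentSet G i)))
    (g := fun M => boxProb μ X (M.map (familySet G i))) (boxProb_zero hX hexch)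
    (boxProb_zero hX hexch) (fun M => boxProb_nonneg _) (fun a M => ?_)
    (fun m m' h => boxProb_mono hX hexch (Multiset.map_le_map h)) (fun m hm => ?_) ?_
  · rw [Multiset.map_cons, Multiset.map_cons,
      ← boxProb_union_cons hX hexch (disjoint_familySet G i a), familySet_union]
    exact hind.boxProb_parentSet_cons_mul hX hexch hG i a M
  · simp only [Multiset.map_add]
    exact boxProb_add_self_pos hX hexch hm
  · rcases le_or_gt 2 (parents G i).ncard with hi | hi
    · exact Or.inl (exists_boxProb_pos_of_seesAllParentValues hX hexch hpos hi)
    -- With at most one parent, a label other than `a` can only be its negation.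
    · refine Or.inr fun a m ha => ⟨fun j => !a j, fun x hx => ?_⟩
      have hsub := (Set.ncard_le_one_iff_subsingleton).1 (Nat.lt_succ_iff.1 hi)
      obtain ⟨j', hj'⟩ := Function.ne_iff.1 fun h : x = a => ha (h ▸ hx)
      funext j
      rw [Subtype.ext (hsub j.2 j'.2)]
      exact Bool.eq_not_of_ne hj'

lemma mechanism_eq_weight {i : Fin d} (θ : Param G i) (a : parents G i → Bool) (b : Bool) :
    mechanism θ a b = weight (θ a : ℝ) b := by
  unfold mechanism
  cases b <;> simp [weight]

lemma IsDAG.exists_maximal (hG : IsDAG G) {S : Finset (Fin d)} (hS : S.Nonempty) :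
    ∃ i ∈ S, ∀ j ∈ S, ¬ Relation.TransGen G.Adj i j := by
  have : IsTrans (Fin d) (flip (Relation.TransGen G.Adj)) := ⟨fun _ _ _ h1 h2 => h2.trans h1⟩
  have : Std.Irrefl (flip (Relation.TransGen G.Adj)) := ⟨hG⟩
  exact (Finite.wellFounded_of_trans_of_irrefl (flip (Relation.TransGen G.Adj))).has_min
    (S : Set (Fin d)) hS

/-- The chain rule along a directed acyclic graph. -/
theorem measureReal_eq_prod_of_ancestral (hX : ∀ i n, Measurable (X i n))
    (hG : IsDAG G) (hind : CausalIndependence μ X G)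
    {N : ℕ} (x : Fin N → Fin d → Bool) (I : Fin d → ℝ)
    (hI : ∀ i, 0 < μ.real {ω | ∀ k : Fin N, tuple X k ω ∈ parentSet G i fun j => x k j} →
      μ.real {ω | ∀ k : Fin N, tuple X k ω ∈ familySet G i (fun j => x k j, x k i)} =
        μ.real {ω | ∀ k : Fin N, tuple X k ω ∈ parentSet G i fun j => x k j} * I i)
    (S : Finset (Fin d)) (hS : ∀ i ∈ S, ∀ j ∈ parents G i, j ∈ S) :
    μ.real {ω | ∀ k : Fin N, ∀ i ∈ S, X i k ω = x k i} = ∏ i ∈ S, I i := by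
  classical
  induction S using Finset.strongInduction with
  | H S ih =>
    rcases S.eq_empty_or_nonempty with rfl | hne
    · simp
    -- Remove a node with no descendants in `S`: the rest stays ancestral and consists of
    -- non-descendants of `i`.
    obtain ⟨i, hiS, hi⟩ := hG.exists_maximal hne
    have hpa : ∀ j ∈ parents G i, j ∈ S.erase i := fun j hj =>
      Finset.mem_erase.2 ⟨(hG.parents_subset_nonDescendants i hj).1, hS i hiS j hj⟩
    have hih := ih (S.erase i) (Finset.erase_ssubset hiS) fun l hl j hj => by
      refine Finset.mem_erase.2 ⟨?_, hS l (Finset.mem_of_mem_erase hl) j hj⟩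
      rintro rfl
      exact hi l (Finset.mem_of_mem_erase hl) (.single hj)
    rw [← Finset.mul_prod_erase S I hiS, ← hih]
    set D := {ω | ∀ k : Fin N, tuple X k ω ∈ parentSet G i fun j => x k j} with hD
    have hDle : ∀ T : Finset (Fin d), (∀ j ∈ parents G i, j ∈ T) →
        {ω | ∀ k : Fin N, ∀ i ∈ T, X i k ω = x k i} ⊆ D := fun T hT ω hω k =>
      funext fun j => hω k j (hT j j.2)
    -- If the parent pattern is null, nothing is known about `I i`, but the probabilities for `S`
    -- and for `S.erase i` both vanish.
    rcases (measureReal_nonneg (μ := μ) (s := D)).eq_or_lt with h0 | h0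
    · have hz : ∀ T : Finset (Fin d), (∀ j ∈ parents G i, j ∈ T) →
          μ.real {ω | ∀ k : Fin N, ∀ i ∈ T, X i k ω = x k i} = 0 := fun T hT =>
        le_antisymm (h0 ▸ measureReal_mono (hDle T hT)) measureReal_nonneg
      rw [hz S fun j hj => Finset.mem_of_mem_erase (hpa j hj), hz _ hpa, mul_zero]
    · have h := (hind i N).measureReal_mul (c := fun k j => x k j)
        (measurable_block hX _ N (MeasurableSet.of_discrete
          (s := {fun (k : Fin N) (j : parents G i) => x k j})))
        (s := {fun k => x k i})
        -- Only the block component is constrained here; the next sample plays no role in the chain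
        -- rule.
        (t := {u | ∀ (k : Fin N) (j : nonParentNonDescendants G i), (j : Fin d) ∈ S →
          u.1 k j = x k j})
        MeasurableSet.of_discrete MeasurableSet.of_discrete
      have e1 : block X (parents G i) N ⁻¹' {fun k (j : parents G i) => x k j} = D := by
        ext ω
        simp [hD, parentSet, tuple, block, funext_iff]
      have e2 : D ∩ (fun ω (m : Fin N) => X i m ω) ⁻¹' {fun k => x k i} =
          {ω | ∀ k : Fin N, tuple X k ω ∈ familySet G i (fun j => x k j, x k i)} := by
        ext ω
        simp [hD, parentSet, familySet, tuple, funext_iff, forall_and]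
      have e3 : D ∩ (fun ω => (block X (nonParentNonDescendants G i) N ω,
            sample X (nonDescendants G i) N ω)) ⁻¹'
            {u | ∀ (k : Fin N) (j : nonParentNonDescendants G i), (j : Fin d) ∈ S →
              u.1 k j = x k j} =
          {ω | ∀ k : Fin N, ∀ j ∈ S.erase i, X j k ω = x k j} := by
        ext ω
        refine ⟨fun ⟨h1, h2⟩ k j hj => ?_, fun hω => ⟨hDle _ hpa hω, fun k j hj => ?_⟩⟩
        · by_cases hjp : j ∈ parents G i
          · exact congrFun (h1 k) ⟨j, hjp⟩
          · have hjS := Finset.mem_erase.1 hj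
            exact h2 k ⟨j, ⟨hjS.1, hi j hjS.2⟩, hjp⟩ hjS.2
        · exact hω k j (Finset.mem_erase.2 ⟨j.2.1.1, hj⟩)
      have e4 : {ω | ∀ k : Fin N, ∀ j ∈ S, X j k ω = x k j} =
          (fun ω (m : Fin N) => X i m ω) ⁻¹' {fun k => x k i} ∩
            {ω | ∀ k : Fin N, ∀ j ∈ S.erase i, X j k ω = x k j} := by
        ext ω
        refine ⟨fun hω => ⟨funext fun k => hω k i hiS, fun k j hj =>
          hω k j (Finset.mem_of_mem_erase hj)⟩, fun ⟨h1, h2⟩ k j hj => ?_⟩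
        by_cases hji : j = i
        · rw [hji]
          exact congrFun h1 k
        · exact h2 k j (Finset.mem_erase.2 ⟨hji, hj⟩)
      rw [e1, Set.inter_left_comm, e3, ← e4, e2, hI i h0] at h
      refine mul_right_cancel₀ h0.ne' ?_
      rw [h]
      ring

end Causal

end CausalDeFinetti

end

/-! ### Assembly of the mixture over independent parameters -/

theorem mainTheorem1 {Ω : Type*} [MeasurableSpace Ω] (μ : Measure Ω) [IsProbabilityMeasure μ]
    {d : ℕ} (X : Fin d → ℕ → Ω → Bool) (hX : ∀ i n, Measurable (X i n))
    (hexch : CausalDeFinetti.InfinitelyExchangeable μ X)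
    (G : Digraph (Fin d)) (hG : CausalDeFinetti.IsDAG G)
    (hind : CausalDeFinetti.CausalIndependence μ X G)
    (hpos : CausalDeFinetti.SeesAllParentValues μ X G) :
    ∃ ν : (i : Fin d) → Measure (CausalDeFinetti.Param G i),
      (∀ i, IsProbabilityMeasure (ν i)) ∧
      ∀ (N : ℕ) (x : Fin N → Fin d → Bool),
        μ.real {ω | ∀ (n : Fin N) (i : Fin d), X i n ω = x n i} =
          ∫ θ : (i : Fin d) → CausalDeFinetti.Param G i,
            ∏ n : Fin N, ∏ i : Fin d,
              CausalDeFinetti.mechanism (θ i) (fun j => x n j) (x n i) ∂(Measure.pi ν) := by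
  choose ν hν hνM using CausalDeFinetti.exists_measure_mechanism hX hexch hG hind hpos
  refine ⟨ν, hν, fun N x => ?_⟩
  have h := CausalDeFinetti.measureReal_eq_prod_of_ancestral hX hG hind x
    (fun i => ∫ θ, ∏ n : Fin N, CausalDeFinetti.mechanism θ (fun j => x n j) (x n i) ∂(ν i))
    (fun i hi => by
      have hM := hνM i (Finset.univ.val.map fun n => (fun j => x n j, x n i))
      simp only [Multiset.map_map, Function.comp_def,
        CausalDeFinetti.boxProb_map_univ hX hexch] at hM
      rw [hM hi]
      congr 2
      funext θ
      simp only [CausalDeFinetti.mechanism_eq_weight, CausalDeFinetti.weights, Multiset.map_map,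
        Function.comp_def]
      rfl)
    Finset.univ (by simp)
  simp only [Finset.mem_univ, true_imp_iff] at h
  rw [h]
  -- With the product over nodes outermost, each factor depends on a single `θ i`, and the integral
  -- over the product measure factorizes.
  simp_rw [Finset.prod_comm (s := (Finset.univ : Finset (Fin N)))]
  exact (integral_fintype_prod_eq_prod fun i (θ : CausalDeFinetti.Param G i) =>
    ∏ n : Fin N, CausalDeFinetti.mechanism θ (fun j => x n j) (x n i)).symm
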